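/- Let $l\ge 1$ and let $G^+_{A_l}$ be the Artin monoid of type $A_l$: the monoid generated by letters $a_1,\dots,a_l$ subject to the relations $a_\alpha a_\beta a_\alpha=a_\beta a_\alpha a_\beta$ if $|\alpha-\beta|=1$ and $a_\alpha a_\beta=a_\beta a_\alpha$ if $|\alpha-\beta|>1$. Let $\deg: G^+_{A_l}\to\mathbb Z_{\ge 0}$ be the map sending the class of a word to the length of the word. Then for every subset $J\subseteq I=\{1,\dots,l\}$ the letters $a_i$, $i\in J$, have a right least common multiple in $G^+_{A_l}$ (a common right multiple that divides every common right multiple from the left); it is unique and is denoted $\Delta_{A_l,J}$, the fundamental element associated with $J$. Put $$N_{A_l}(t)=\sum_{J\subseteq I}(-1)^{\#J}t^{\deg(\Delta_{A_l,J})},\qquad N_{A_l,j}(t)=\sum_{J\subseteq I,\ \#J=j}t^{\deg(\Delta_{A_l,J})},\qquad C_{A_l,j}=N_{A_l,j}'(1)=\sum_{J\subseteq I,\ \#J=j}\deg(\Delta_{A_l,J}).$$ **Theorem.** For all integers $l\ge j\ge 1$, $$C_{A_{l+1},j+1}-C_{A_l,j}=(j+1)\binom{l+1}{j+1}.$$ Moreover,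 for every $l\ge 1$, $N'_{A_{l+1}}(1)+N'_{A_l}(1)=0$ and $N'_{A_l}(1)=(-1)^l$. -/

import Mathlib

open scoped Polynomial

namespace ArtinMonoid

variable {B : Type*}

/-- The defining relations `⟨a_i a_j⟩^{m(i,j)} = ⟨a_j a_i⟩^{m(i,j)}` of the Artin monoid: the two
alternating words of length `m(i,j)` in the letters `a_i, a_j` are identified. (In Mathlib the value
`m(i,j) = 0` encodes `∞`; then both words are empty and no relation is imposed.) -/
def braidRel (M : CoxeterMatrix B) (u v : FreeMonoid B) : Prop :=
  ∃ i j : B, u = FreeMonoid.ofList (CoxeterSystem.braidWord M i j) ∧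
    v = FreeMonoid.ofList (CoxeterSystem.braidWord M j i)

end ArtinMonoid

/-- The Artin monoid `G_M⁺` of a Coxeter matrix `M`. -/
abbrev ArtinMonoid {B : Type*} (M : CoxeterMatrix B) : Type _ :=
  PresentedMonoid (ArtinMonoid.braidRel M)

namespace ArtinMonoid

variable {B : Type*} (M : CoxeterMatrix B)

/-- The letter `a_i` as an element of the Artin monoid. -/
def letter (i : B) : ArtinMonoid M := PresentedMonoid.of (braidRel M) i

theorem lift_length (w : FreeMonoid B) :
    FreeMonoid.lift (fun _ : B => Multiplicative.ofAdd (1 : ℕ)) w =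
      Multiplicative.ofAdd w.length := by
  induction w using FreeMonoid.inductionOn' with
  | one => simp
  | of_mul a w ih =>
    rw [map_mul, ih, FreeMonoid.lift_eval_of, FreeMonoid.length_mul, FreeMonoid.length_of]
    rfl

/-- The degree homomorphism: it sends every letter to `1`. -/
def degHom : ArtinMonoid M →* Multiplicative ℕ :=
  PresentedMonoid.lift (fun _ : B => Multiplicative.ofAdd (1 : ℕ)) (by
    rintro u v ⟨i, j, rfl, rfl⟩
    rw [lift_length, lift_length]
    congr 1
    change (CoxeterSystem.braidWord M i j).length = (CoxeterSystem.braidWord M j i).length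
    rw [CoxeterSystem.length_alternatingWord, CoxeterSystem.length_alternatingWord,
      M.symmetric])

/-- The degree of an element of the Artin monoid: the length of any word representing it
(see `deg_mk`). -/
def deg (x : ArtinMonoid M) : ℕ := Multiplicative.toAdd (degHom M x)

theorem deg_mk (w : FreeMonoid B) : deg M (PresentedMonoid.mk (braidRel M) w) = w.length := by
  change Multiplicative.toAdd (FreeMonoid.lift (fun _ : B => Multiplicative.ofAdd (1 : ℕ)) w) = _
  rw [lift_length]
  rfl

theorem deg_mul (x y : ArtinMonoid M) : deg M (x * y) = deg M x + deg M y := by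
  simp [deg, toAdd_mul]

theorem eq_one_of_deg_eq_zero (x : ArtinMonoid M) (h : deg M x = 0) : x = 1 := by
  obtain ⟨w, rfl⟩ := PresentedMonoid.surjective_mk x
  rw [deg_mk, FreeMonoid.length_eq_zero] at h
  rw [h, map_one]

/-- `D` is the right least common multiple of the letters `a_i`, `i ∈ J`. Here `x ∣ y` in the
(noncommutative) monoid means `y = x * z` for some `z`, that is, `y` is a right multiple of `x`. -/
def IsRightLCM (J : Finset B) (D : ArtinMonoid M) : Prop :=
  (∀ i ∈ J, letter M i ∣ D) ∧ ∀ E : ArtinMonoid M, (∀ i ∈ J, letter M i ∣ E) → D ∣ E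

/-- A right least common multiple is unique. -/
theorem IsRightLCM.unique {J : Finset B} {D E : ArtinMonoid M}
    (hD : IsRightLCM M J D) (hE : IsRightLCM M J E) : D = E := by
  obtain ⟨x, hx⟩ := hD.2 E hE.1
  obtain ⟨y, hy⟩ := hE.2 D hD.1
  have h1 := congrArg (deg M) hx
  have h2 := congrArg (deg M) hy
  rw [deg_mul] at h1 h2
  have h3 : x = 1 := eq_one_of_deg_eq_zero M x (by omega)
  rw [hx, h3, mul_one]

open Classical in
/-- The fundamental element `Δ_J`: the right least common multiple of the letters `a_i`, `i ∈ J`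
(with the value `1` if it does not exist). -/
noncomputable def fundamentalElement (J : Finset B) : ArtinMonoid M :=
  if h : ∃ D, IsRightLCM M J D then h.choose else 1

/-- The skew-growth function `N_M(t) = ∑_J (-1)^{#J} t^{deg Δ_J}`. -/
noncomputable def skewGrowth [Fintype B] : ℤ[X] :=
  ∑ J : Finset B, (-1) ^ J.card * Polynomial.X ^ deg M (fundamentalElement M J)

/-- `N_{M,j}(t) = ∑_{#J = j} t^{deg Δ_J}`. -/
noncomputable def skewGrowthPart [Fintype B] (j : ℕ) : ℤ[X] :=
  ∑ J ∈ (Finset.univ : Finset B).powersetCard j, Polynomial.X ^ deg M (fundamentalElement M J)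

/-- `C_{M,j}`: the derivative of `N_{M,j}(t)` at `t = 1`. -/
noncomputable def levelC [Fintype B] (j : ℕ) : ℤ :=
  (Polynomial.derivative (skewGrowthPart M j)).eval 1

theorem levelC_eq_sum [Fintype B] (j : ℕ) :
    levelC M j = ∑ J ∈ (Finset.univ : Finset B).powersetCard j,
      (deg M (fundamentalElement M J) : ℤ) := by
  simp [levelC, skewGrowthPart, Polynomial.eval_finsetSum, Polynomial.derivative_X_pow]

end ArtinMonoid

namespace ArtinMonoid

/-! ### Two letters at a time: equalities explained by a least common multiple. -/

section SimplyLaced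

variable {B : Type*} {M : CoxeterMatrix B}

/-! The key fact is a count: the degree of Δ_J is the number of nonempty intervals of consecutive
indices inside J (`deg_fundamentalElement_A`). Exchanging sums, an interval of size s contributes
the total weight of its supersets J. For fixed #J = j this is C(l-s, j-s). Shortening by one matches
the intervals of size at least 2 in A_{l+1} with all intervals in A_l and keeps the size of the
complement, so the difference of the two levels comes from the l+1 singletons: (l+1)C(l,j) =
(j+1)C(l+1,j+1). With signs, a contribution vanishes unless the interval is all of I, which leaves
(-1)^l.

The count comes from an explicit Δ_J: the product, over increasing m in J, of the descending runs
a_m a_{m-1} ⋯ through J (`isRightLCM_runProduct`). Minimality of this product rests on Garside's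
lemma (`explained_of_letter_mul_eq`), proved by induction on degree. A chain of relations is
collapsed one intermediate word at a time, and each collapse is a cube condition on three letters.
-/

theorem mk_of_mul (i : B) (w : FreeMonoid B) :
    PresentedMonoid.mk (braidRel M) (FreeMonoid.of i * w) =
      letter M i * PresentedMonoid.mk (braidRel M) w := by
  rw [map_mul]; rfl

theorem deg_one : deg M 1 = 0 := by
  simp [deg]

theorem deg_letter (i : B) : deg M (letter M i) = 1 := by
  change deg M (PresentedMonoid.mk _ (FreeMonoid.of i)) = 1
  rw [deg_mk, FreeMonoid.length_of]

theorem letter_comm {i j : B} (h : M i j = 2) :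
    letter M i * letter M j = letter M j * letter M i := by
  have := PresentedMonoid.mk_eq_mk_of_rel (rels := braidRel M) ⟨i, j, rfl, rfl⟩
  rw [CoxeterSystem.braidWord, CoxeterSystem.braidWord, M.symmetric j i, h] at this
  exact this

theorem letter_comm_assoc {i j : B} (h : M i j = 2) (x : ArtinMonoid M) :
    letter M i * (letter M j * x) = letter M j * (letter M i * x) := by
  rw [← mul_assoc, letter_comm h, mul_assoc]

theorem letter_braid {i j : B} (h : M i j = 3) :
    letter M i * (letter M j * letter M i) = letter M j * (letter M i * letter M j) := by
  have := PresentedMonoid.mk_eq_mk_of_rel (rels := braidRel M) ⟨i, j, rfl, rfl⟩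
  rw [CoxeterSystem.braidWord, CoxeterSystem.braidWord, M.symmetric j i, h] at this
  exact this.symm

theorem letter_braid_assoc {i j : B} (h : M i j = 3) (x : ArtinMonoid M) :
    letter M i * (letter M j * (letter M i * x)) =
      letter M j * (letter M i * (letter M j * x)) := by
  simpa only [mul_assoc] using congrArg (· * x) (letter_braid h)

/-- The equality `a_i x = a_j y` is explained by the least common multiple of `a_i` and `a_j`. -/
def Explained (M : CoxeterMatrix B) (i : B) (x : ArtinMonoid M) (j : B) (y : ArtinMonoid M) :
    Prop :=
  (i = j ∧ x = y) ∨
    (M i j = 3 ∧ ∃ z, x = letter M j * (letter M i * z) ∧ y = letter M i * (letter M j * z)) ∨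
    (M i j = 2 ∧ ∃ z, x = letter M j * z ∧ y = letter M i * z)

theorem Explained.symm {i j : B} {x y : ArtinMonoid M} (h : Explained M i x j y) :
    Explained M j y i x := by
  rcases h with ⟨rfl, rfl⟩ | ⟨h, z, rfl, rfl⟩ | ⟨h, z, rfl, rfl⟩
  · exact .inl ⟨rfl, rfl⟩
  · exact .inr (.inl ⟨M.symmetric j i ▸ h, z, rfl, rfl⟩)
  · exact .inr (.inr ⟨M.symmetric j i ▸ h, z, rfl, rfl⟩)

theorem Explained.mul_right {i j : B} {x y : ArtinMonoid M} (h : Explained M i x j y)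
    (t : ArtinMonoid M) : Explained M i (x * t) j (y * t) := by
  rcases h with ⟨rfl, rfl⟩ | ⟨h, z, rfl, rfl⟩ | ⟨h, z, rfl, rfl⟩
  · exact .inl ⟨rfl, rfl⟩
  · exact .inr (.inl ⟨h, z * t, by simp only [mul_assoc], by simp only [mul_assoc]⟩)
  · exact .inr (.inr ⟨h, z * t, by simp only [mul_assoc], by simp only [mul_assoc]⟩)

theorem Explained.eq_of_diag {i : B} {x y : ArtinMonoid M} (h : Explained M i x i y) : x = y := by
  rcases h with ⟨-, h⟩ | ⟨h, -⟩ | ⟨h, -⟩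
  · exact h
  · simp at h
  · simp at h

theorem Explained.of_comm {i j : B} {x y : ArtinMonoid M} (h : Explained M i x j y)
    (hij : M i j = 2) : ∃ z, x = letter M j * z ∧ y = letter M i * z := by
  rcases h with ⟨rfl, -⟩ | ⟨h, -⟩ | ⟨-, h⟩
  · simp at hij
  · omega
  · exact h

theorem Explained.of_braid {i j : B} {x y : ArtinMonoid M} (h : Explained M i x j y)
    (hij : M i j = 3) :
    ∃ z, x = letter M j * (letter M i * z) ∧ y = letter M i * (letter M j * z) := by
  rcases h with ⟨rfl, -⟩ | ⟨-, h⟩ | ⟨h, -⟩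
  · simp at hij
  · exact h
  · omega

/-- A Coxeter matrix whose graph is simply laced and has no triangle. -/
structure SimplyLacedTriangleFree (M : CoxeterMatrix B) : Prop where
  eq_two_or_three : ∀ i j, i ≠ j → M i j = 2 ∨ M i j = 3
  triangle_free : ∀ i j k, i ≠ k → M i j = 3 → M j k = 3 → M i k = 2

/-- In degree less than `n` every equality `a_i x = a_j y` is explained. -/
def ExplainedBelow (M : CoxeterMatrix B) (n : ℕ) : Prop :=
  ∀ i j (x y : ArtinMonoid M), deg M x < n → letter M i * x = letter M j * y → Explained M i x j y

theorem ExplainedBelow.cancel {n : ℕ} (H : ExplainedBelow M n) {i : B} {x y : ArtinMonoid M}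
    (hx : deg M x < n) (h : letter M i * x = letter M i * y) : x = y :=
  (H i i x y hx h).eq_of_diag


end SimplyLaced
end ArtinMonoid

namespace ArtinMonoid

/-! ### Cube conditions and Garside's lemma. -/

section Cube

variable {B : Type*} {M : CoxeterMatrix B}

theorem Explained.trans_of_eq {n : ℕ} (H : ExplainedBelow M n) {i k : B}
    {x y w : ArtinMonoid M} (hw : deg M w ≤ n) (h₁ : Explained M i x k w)
    (h₂ : Explained M k w i y) : Explained M i x i y := by
  refine .inl ⟨rfl, ?_⟩
  rcases h₁ with ⟨rfl, rfl⟩ | ⟨hik, z, rfl, rfl⟩ | ⟨hik, z, rfl, rfl⟩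
  · exact h₂.eq_of_diag
  · obtain ⟨z', hz, rfl⟩ := h₂.of_braid (M.symmetric k i ▸ hik)
    simp only [deg_mul, deg_letter] at hw
    have h := H.cancel (by simp only [deg_mul, deg_letter]; omega) hz
    rw [H.cancel (by omega) h]
  · obtain ⟨z', hz, rfl⟩ := h₂.of_comm (M.symmetric k i ▸ hik)
    simp only [deg_mul, deg_letter] at hw
    rw [H.cancel (by omega) hz]

/-- The cube condition for three pairwise commuting letters. -/
theorem explained_of_comm_comm_comm {n : ℕ} (H : ExplainedBelow M n) {i j k : B}
    {z z' : ArtinMonoid M} (hz : deg M z < n) (hik : M i k = 2) (hkj : M k j = 2)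
    (hij : M i j = 2) (h : letter M i * z = letter M j * z') :
    Explained M i (letter M k * z) j (letter M k * z') := by
  obtain ⟨u, rfl, rfl⟩ := (H _ _ _ _ hz h).of_comm hij
  exact .inr (.inr ⟨hij, letter M k * u, letter_comm_assoc hkj u,
    (letter_comm_assoc hik u).symm⟩)

/-- The cube condition when the middle letter commutes with two braided letters. -/
theorem explained_of_comm_comm_braid {n : ℕ} (H : ExplainedBelow M n) {i j k : B}
    {z z' : ArtinMonoid M} (hz : deg M z < n) (hik : M i k = 2) (hkj : M k j = 2)
    (hij : M i j = 3) (h : letter M i * z = letter M j * z') :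
    Explained M i (letter M k * z) j (letter M k * z') := by
  obtain ⟨u, rfl, rfl⟩ := (H _ _ _ _ hz h).of_braid hij
  refine .inr (.inl ⟨hij, letter M k * u, ?_, ?_⟩)
  · rw [letter_comm_assoc hkj, letter_comm_assoc hik]
  · rw [← letter_comm_assoc hik, letter_comm_assoc hkj]

/-- The cube condition when the last letter commutes with two braided letters. -/
theorem explained_of_braid_comm_comm {n : ℕ} (H : ExplainedBelow M n) {i j k : B}
    {z z' : ArtinMonoid M} (hz : deg M z + 1 < n) (hik : M i k = 3) (hkj : M k j = 2)
    (hij : M i j = 2) (h : letter M i * (letter M k * z) = letter M j * z') :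
    Explained M i (letter M k * (letter M i * z)) j (letter M k * z') := by
  obtain ⟨u, hu, rfl⟩ :=
    (H _ _ _ _ (by rw [deg_mul, deg_letter]; omega) h).of_comm hij
  obtain ⟨v, rfl, rfl⟩ := (H _ _ _ _ (by omega) hu).of_comm hkj
  refine .inr (.inr ⟨hij, letter M k * (letter M i * v), ?_, ?_⟩)
  · rw [letter_comm_assoc hij, letter_comm_assoc hkj]
  · rw [letter_braid_assoc hik]

/-- The cube condition for a path of three letters whose centre is the middle letter. -/
theorem explained_of_braid_braid_comm {n : ℕ} (H : ExplainedBelow M n) {i j k : B}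
    {z z' : ArtinMonoid M} (hz : deg M z + 1 < n) (hz' : deg M z' + 1 < n) (hik : M i k = 3)
    (hkj : M k j = 3) (hij : M i j = 2)
    (h : letter M i * (letter M k * z) = letter M j * (letter M k * z')) :
    Explained M i (letter M k * (letter M i * z)) j (letter M k * (letter M j * z')) := by
  obtain ⟨u, hu, hu'⟩ :=
    (H _ _ _ _ (by rw [deg_mul, deg_letter]; omega) h).of_comm hij
  obtain ⟨v, rfl, rfl⟩ := (H _ _ _ _ (by omega) hu).of_braid hkj
  obtain ⟨v', rfl, hv⟩ :=
    (H _ _ _ _ (by omega) hu').of_braid (M.symmetric k i ▸ hik)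
  have hv := H.cancel (by simp only [deg_mul, deg_letter] at hz ⊢; omega) hv
  obtain ⟨t, rfl, rfl⟩ :=
    (H _ _ _ _ (by simp only [deg_mul, deg_letter] at hz ⊢; omega) hv).of_comm
      (M.symmetric i j ▸ hij)
  -- For t = 1, prefixing a_i a_j gives the fundamental element of A_3, of degree 6: the least
  -- common multiple of the three letters.
  refine .inr (.inr ⟨hij, letter M k * (letter M j * (letter M i * (letter M k * t))), ?_, ?_⟩)
  · rw [letter_comm_assoc hij, letter_braid_assoc hik, ← letter_braid_assoc hkj]
  · rw [← letter_comm_assoc hij, ← letter_comm_assoc hij, letter_braid_assoc hik,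
      ← letter_braid_assoc hkj]

/-- The cube condition for a path of three letters whose centre is the first letter. -/
theorem explained_of_braid_comm_braid {n : ℕ} (H : ExplainedBelow M n) {i j k : B}
    {z z' : ArtinMonoid M} (hz : deg M z + 1 < n) (hik : M i k = 3)
    (hkj : M k j = 2) (hij : M i j = 3)
    (h : letter M i * (letter M k * z) = letter M j * z') :
    Explained M i (letter M k * (letter M i * z)) j (letter M k * z') := by
  obtain ⟨u, hu, rfl⟩ :=
    (H _ _ _ _ (by rw [deg_mul, deg_letter]; omega) h).of_braid hij
  obtain ⟨v, rfl, hv⟩ := (H _ _ _ _ (by omega) hu).of_comm hkj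
  have hdeg := congrArg (deg M) hv
  simp only [deg_mul, deg_letter] at hz hdeg
  obtain ⟨t, rfl, rfl⟩ := (H _ _ _ _ (by omega) hv).of_braid hik
  refine .inr (.inl ⟨hij, letter M k * (letter M i * (letter M j * t)), ?_, ?_⟩)
  · rw [letter_braid_assoc hij, letter_comm_assoc hkj, ← letter_comm_assoc hkj t,
      letter_braid_assoc hik]
  · rw [← letter_comm_assoc hkj, ← letter_braid_assoc hik, letter_braid_assoc hij,
      letter_comm_assoc hkj]

/-- Explanations compose: the cube condition for the Artin monoid. -/
theorem Explained.trans (hM : SimplyLacedTriangleFree M) {n : ℕ} (H : ExplainedBelow M n)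
    {i j k : B} {x y w : ArtinMonoid M} (hw : deg M w ≤ n) (h₁ : Explained M i x k w)
    (h₂ : Explained M k w j y) : Explained M i x j y := by
  by_cases hne : i = j
  · subst hne
    exact h₁.trans_of_eq H hw h₂
  rcases h₁ with ⟨rfl, rfl⟩ | ⟨hik, z, rfl, rfl⟩ | ⟨hik, z, rfl, rfl⟩
  · exact h₂
  · rcases h₂ with ⟨rfl, rfl⟩ | ⟨hkj, z', hz, rfl⟩ | ⟨hkj, z', hz, rfl⟩
    · exact .inr (.inl ⟨hik, z, rfl, rfl⟩)
    · have hw' := hw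
      rw [hz] at hw'
      simp only [deg_mul, deg_letter] at hw hw'
      -- Two braided pairs sharing k force i and j to commute, since the graph has no triangle.
      exact explained_of_braid_braid_comm H (by omega) (by omega) hik hkj
        (hM.triangle_free _ _ _ hne hik hkj) hz
    · simp only [deg_mul, deg_letter] at hw
      rcases hM.eq_two_or_three i j hne with hij | hij
      · exact explained_of_braid_comm_comm H (by omega) hik hkj hij hz
      · exact explained_of_braid_comm_braid H (by omega) hik hkj hij hz
  · rcases h₂ with ⟨rfl, rfl⟩ | ⟨hkj, z', hz, rfl⟩ | ⟨hkj, z', hz, rfl⟩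
    · exact .inr (.inr ⟨hik, z, rfl, rfl⟩)
    · rw [hz] at hw
      simp only [deg_mul, deg_letter] at hw
      have hjk := M.symmetric j k ▸ hkj
      have hki := M.symmetric k i ▸ hik
      -- Read backwards, the chain has its braided pair first, as the cube lemmas require.
      apply Explained.symm
      rcases hM.eq_two_or_three j i (Ne.symm hne) with hij | hij
      · exact explained_of_braid_comm_comm H (by omega) hjk hki hij hz.symm
      · exact explained_of_braid_comm_braid H (by omega) hjk hki hij hz.symm
    · simp only [deg_mul, deg_letter] at hw
      rcases hM.eq_two_or_three i j hne with hij | hij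
      · exact explained_of_comm_comm_comm H (by omega) hik hkj hij hz
      · exact explained_of_comm_comm_braid H (by omega) hik hkj hij hz

/-- Induction on the generation of the congruence, following only the first letters. Transitivity is
the one hard case, and there the cube condition applies. -/
theorem explained_of_rel (hM : SimplyLacedTriangleFree M) {n : ℕ} (H : ExplainedBelow M n)
    {u v : FreeMonoid B} (h : ConGen.Rel (braidRel M) u v) (hu : u.length ≤ n + 1) :
    (u = 1 ∧ v = 1) ∨ ∃ i j X Y, u = FreeMonoid.of i * X ∧ v = FreeMonoid.of j * Y ∧
      Explained M i (PresentedMonoid.mk _ X) j (PresentedMonoid.mk _ Y) := by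
  have length_eq {u v : FreeMonoid B} (h : ConGen.Rel (braidRel M) u v) :
      u.length = v.length := by
    rw [← deg_mk M u, ← deg_mk M v]
    exact congrArg (deg M) (PresentedMonoid.mk_eq_mk_iff.2 h)
  have refl_case (w : FreeMonoid B) : (w = 1 ∧ w = 1) ∨ ∃ i j X Y,
      w = FreeMonoid.of i * X ∧ w = FreeMonoid.of j * Y ∧
      Explained M i (PresentedMonoid.mk _ X) j (PresentedMonoid.mk _ Y) := by
    cases w using FreeMonoid.casesOn with
    | one => exact .inl ⟨rfl, rfl⟩
    | of_mul i X => exact .inr ⟨i, i, X, X, rfl, rfl, .inl ⟨rfl, rfl⟩⟩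
  induction h with
  | of u v h =>
    obtain ⟨i, j, rfl, rfl⟩ := h
    by_cases hij : i = j
    · subst hij
      exact refl_case _
    rcases hM.eq_two_or_three i j hij with h | h
    · refine .inr ⟨i, j, FreeMonoid.of j, FreeMonoid.of i, ?_, ?_, .inr (.inr ⟨h, 1, ?_, ?_⟩)⟩
      · rw [CoxeterSystem.braidWord, h]; rfl
      · rw [CoxeterSystem.braidWord, M.symmetric, h]; rfl
      · rw [mul_one]; rfl
      · rw [mul_one]; rfl
    -- Alternating words end in their second argument, so the word of odd length 3 for (i, j) begins
    -- with j.
    · refine .inr ⟨j, i, FreeMonoid.of i * FreeMonoid.of j, FreeMonoid.of j * FreeMonoid.of i,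
        ?_, ?_, .inr (.inl ⟨M.symmetric i j ▸ h, 1, ?_, ?_⟩)⟩
      · rw [CoxeterSystem.braidWord, h]; rfl
      · rw [CoxeterSystem.braidWord, M.symmetric, h]; rfl
      · rw [mul_one]; rfl
      · rw [mul_one]; rfl
  | refl w => exact refl_case w
  | symm h ih =>
    rcases ih (length_eq h ▸ hu) with ⟨h₁, h₂⟩ | ⟨i, j, X, Y, h₁, h₂, hE⟩
    · exact .inl ⟨h₂, h₁⟩
    · exact .inr ⟨j, i, Y, X, h₂, h₁, hE.symm⟩
  | trans h h' ih ih' =>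
    have hv := length_eq h ▸ hu
    rcases ih hu with ⟨h₁, h₂⟩ | ⟨i, k, X, W, h₁, h₂, hE⟩
    · rcases ih' hv with ⟨h₃, h₄⟩ | ⟨k', j, W', Y, h₃, h₄, hE'⟩
      · exact .inl ⟨h₁, h₄⟩
      · have := congrArg FreeMonoid.length (h₂.symm.trans h₃)
        simp at this
        omega
    · rcases ih' hv with ⟨h₃, h₄⟩ | ⟨k', j, W', Y, h₃, h₄, hE'⟩
      · have := congrArg FreeMonoid.length (h₃.symm.trans h₂)
        simp at this
        omega
      · obtain ⟨rfl, rfl⟩ : k = k' ∧ W = W' := by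
          have := congrArg FreeMonoid.toList (h₂.symm.trans h₃)
          simpa using this
        refine .inr ⟨i, j, X, Y, h₁, h₄, hE.trans hM H ?_ hE'⟩
        rw [h₂] at hv
        simp at hv
        rw [deg_mk]
        omega
  | @mul u v s t h h' ih ih' =>
    rw [FreeMonoid.length_mul] at hu
    -- If the left factors are empty, the first letters lie in the right factors; otherwise the
    -- right factors, equal in the monoid, multiply the explanation.
    rcases ih (by omega) with ⟨rfl, rfl⟩ | ⟨i, j, X, Y, rfl, rfl, hE⟩
    · simpa using ih' (by omega)
    · refine .inr ⟨i, j, X * s, Y * t, mul_assoc _ _ _, mul_assoc _ _ _, ?_⟩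
      rw [map_mul, map_mul, PresentedMonoid.mk_eq_mk_iff.2 h']
      exact hE.mul_right _

theorem explainedBelow (hM : SimplyLacedTriangleFree M) (n : ℕ) : ExplainedBelow M n := by
  induction n with
  | zero => intro i j x y hx; omega
  | succ n H =>
    intro i j x y hx h
    obtain ⟨X, rfl⟩ := PresentedMonoid.surjective_mk x
    obtain ⟨Y, rfl⟩ := PresentedMonoid.surjective_mk y
    rw [← mk_of_mul, ← mk_of_mul] at h
    rw [deg_mk] at hx
    rcases explained_of_rel hM H (PresentedMonoid.mk_eq_mk_iff.1 h) (by simp; omega) with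
      ⟨h₁, -⟩ | ⟨i', j', X', Y', h₁, h₂, hE⟩
    · have := congrArg FreeMonoid.length h₁
      simp at this
    · obtain ⟨rfl, rfl⟩ : i = i' ∧ X = X' := by simpa using congrArg FreeMonoid.toList h₁
      obtain ⟨rfl, rfl⟩ : j = j' ∧ Y = Y' := by simpa using congrArg FreeMonoid.toList h₂
      exact hE

/-- Garside's lemma: every equality `a_i x = a_j y` in the Artin monoid is explained by the least
common multiple of `a_i` and `a_j`. -/
theorem explained_of_letter_mul_eq (hM : SimplyLacedTriangleFree M) {i j : B}
    {x y : ArtinMonoid M} (h : letter M i * x = letter M j * y) : Explained M i x j y :=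
  explainedBelow hM (deg M x + 1) i j x y (Nat.lt_succ_self _) h

theorem letter_mul_cancel (hM : SimplyLacedTriangleFree M) {i : B} {x y : ArtinMonoid M}
    (h : letter M i * x = letter M i * y) : x = y :=
  (explained_of_letter_mul_eq hM h).eq_of_diag

end Cube
end ArtinMonoid

namespace ArtinMonoid

/-! ### Type A: the fundamental element as a product of descending runs. -/

section TypeA

variable {l : ℕ}

theorem matrixA_apply (i j : Fin l) : CoxeterMatrix.A l i j =
    if i = j then 1 else if (j : ℕ) + 1 = i ∨ (i : ℕ) + 1 = j then 3 else 2 := rfl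

theorem matrixA_eq_two {i j : Fin l} (h : (i : ℕ) + 1 < j) : CoxeterMatrix.A l j i = 2 := by
  rw [matrixA_apply, if_neg (by rw [Fin.ext_iff]; omega), if_neg (by omega)]

theorem matrixA_eq_three {i j : Fin l} (h : (i : ℕ) + 1 = j) : CoxeterMatrix.A l j i = 3 := by
  rw [matrixA_apply, if_neg (by rw [Fin.ext_iff]; omega), if_pos (by omega)]

theorem simplyLacedTriangleFree_A (l : ℕ) : SimplyLacedTriangleFree (CoxeterMatrix.A l) where
  eq_two_or_three i j h := by
    rw [matrixA_apply, if_neg h]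
    split_ifs <;> simp
  triangle_free i j k hik hij hjk := by
    rw [matrixA_apply] at hij hjk ⊢
    rw [Ne, Fin.ext_iff] at hik
    simp only [Fin.ext_iff] at hij hjk ⊢
    split_ifs at hij hjk ⊢ <;> omega

/-- The product `a_{m-1} a_{m-2} ⋯ a_c` over the longest run of consecutive elements of `J`
that ends at `m - 1`. -/
noncomputable def descendingRun (J : Finset (Fin l)) : ℕ → ArtinMonoid (CoxeterMatrix.A l)
  | 0 => 1
  | m + 1 => open Classical in
    if h : ∃ h : m < l, (⟨m, h⟩ : Fin l) ∈ J then
      letter (CoxeterMatrix.A l) ⟨m, h.1⟩ * descendingRun J m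
    else 1

/-- The product of the descending runs of `J` that end below `m`; it is the fundamental element
of `J ∩ {0, …, m - 1}`. -/
noncomputable def runProduct (J : Finset (Fin l)) : ℕ → ArtinMonoid (CoxeterMatrix.A l)
  | 0 => 1
  | m + 1 => runProduct J m * descendingRun J (m + 1)

variable {J : Finset (Fin l)}

theorem descendingRun_zero : descendingRun J 0 = 1 := rfl

theorem descendingRun_succ_of_mem {m : ℕ} (hm : m < l) (h : (⟨m, hm⟩ : Fin l) ∈ J) :
    descendingRun J (m + 1) = letter (CoxeterMatrix.A l) ⟨m, hm⟩ * descendingRun J m := by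
  rw [descendingRun, dif_pos ⟨hm, h⟩]

theorem descendingRun_succ_of_notMem {m : ℕ} (h : ¬ ∃ h : m < l, (⟨m, h⟩ : Fin l) ∈ J) :
    descendingRun J (m + 1) = 1 := by
  rw [descendingRun, dif_neg h]

/-- The run only involves indices below m, hence at distance at least 2 from i. -/
theorem letter_mul_descendingRun {m : ℕ} {i : Fin l} (h : m < i) :
    letter _ i * descendingRun J m = descendingRun J m * letter _ i := by
  induction m with
  | zero => simp [descendingRun_zero]
  | succ m ih =>
    by_cases hm : ∃ h : m < l, (⟨m, h⟩ : Fin l) ∈ J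
    · obtain ⟨hl, hm⟩ := hm
      rw [descendingRun_succ_of_mem hl hm, letter_comm_assoc (matrixA_eq_two (by simpa using h)),
        ih (by omega), mul_assoc]
    · rw [descendingRun_succ_of_notMem hm, mul_one, one_mul]

theorem letter_dvd_of_dvd_letter_mul {i j : Fin l} (h : (i : ℕ) + 1 < j)
    {e : ArtinMonoid (CoxeterMatrix.A l)} (hd : letter _ j ∣ letter _ i * e) :
    letter _ j ∣ e := by
  obtain ⟨y, hy⟩ := hd
  obtain ⟨z, -, hz⟩ := (explained_of_letter_mul_eq (simplyLacedTriangleFree_A l) hy.symm).of_comm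
    (matrixA_eq_two h)
  exact ⟨z, hz⟩

theorem letter_dvd_of_dvd_descendingRun_mul {m : ℕ} {i : Fin l} (h : m < i)
    {e : ArtinMonoid (CoxeterMatrix.A l)} (hd : letter _ i ∣ descendingRun J m * e) :
    letter _ i ∣ e := by
  induction m with
  | zero => simpa [descendingRun_zero] using hd
  | succ m ih =>
    by_cases hm : ∃ h : m < l, (⟨m, h⟩ : Fin l) ∈ J
    · obtain ⟨hl, hm⟩ := hm
      rw [descendingRun_succ_of_mem hl hm, mul_assoc] at hd
      exact ih (by omega) (letter_dvd_of_dvd_letter_mul (by simpa using h) hd)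
    · rwa [descendingRun_succ_of_notMem hm, one_mul] at hd

/-- Minimality for one run. Writing D_m for `descendingRun J m`, Garside's lemma turns a_{k+1} ∣ a_k
D_k e into D_k e = a_{k+1} a_k z. As a_{k+1} passes D_k, it splits off e, and cancelling it leaves
the same problem for k. -/
theorem descendingRun_succ_dvd {m : ℕ} (hl : m < l) (hm : (⟨m, hl⟩ : Fin l) ∈ J)
    {e : ArtinMonoid (CoxeterMatrix.A l)} (hd : letter _ ⟨m, hl⟩ ∣ descendingRun J m * e) :
    descendingRun J (m + 1) ∣ e := by
  induction m generalizing e with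
  | zero => simpa [descendingRun_succ_of_mem hl hm, descendingRun_zero] using hd
  | succ k ih =>
    rw [descendingRun_succ_of_mem hl hm]
    by_cases hk : ∃ h : k < l, (⟨k, h⟩ : Fin l) ∈ J
    · obtain ⟨hkl, hk⟩ := hk
      rw [descendingRun_succ_of_mem hkl hk, mul_assoc] at hd
      obtain ⟨y, hy⟩ := hd
      obtain ⟨z, -, hz⟩ :=
        (explained_of_letter_mul_eq (simplyLacedTriangleFree_A l) hy.symm).of_braid
          (matrixA_eq_three rfl)
      obtain ⟨e, rfl⟩ := letter_dvd_of_dvd_descendingRun_mul (Nat.lt_succ_self k) ⟨_, hz⟩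
      rw [← mul_assoc, ← letter_mul_descendingRun (Nat.lt_succ_self k), mul_assoc] at hz
      exact mul_dvd_mul_left _
        (ih hkl hk ⟨z, letter_mul_cancel (simplyLacedTriangleFree_A l) hz⟩)
    · rw [descendingRun_succ_of_notMem hk, one_mul] at hd
      rwa [descendingRun_succ_of_notMem hk, mul_one]

/-- With D_m = `descendingRun J m`, commutation gives D_{k+1} D_{k+2} = a_k a_{k+1} D_k D_{k+1} when
k ∈ J. By induction this is a_k a_{k+1} a_k y, and the braid relation brings a_{k+1} to the front.
-/
theorem letter_dvd_descendingRun_mul {m : ℕ} (hl : m < l) (hm : (⟨m, hl⟩ : Fin l) ∈ J) :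
    letter _ ⟨m, hl⟩ ∣ descendingRun J m * descendingRun J (m + 1) := by
  induction m with
  | zero => simp [descendingRun_succ_of_mem hl hm, descendingRun_zero]
  | succ k ih =>
    rw [descendingRun_succ_of_mem hl hm]
    by_cases hk : ∃ h : k < l, (⟨k, h⟩ : Fin l) ∈ J
    · obtain ⟨hkl, hk⟩ := hk
      obtain ⟨y, hy⟩ := ih hkl hk
      refine ⟨letter _ ⟨k, hkl⟩ * (letter _ ⟨k + 1, hl⟩ * y), ?_⟩
      rw [letter_braid_assoc (matrixA_eq_three rfl), ← hy]
      nth_rw 1 [descendingRun_succ_of_mem hkl hk]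
      rw [mul_assoc, ← mul_assoc (descendingRun J k),
        ← letter_mul_descendingRun (Nat.lt_succ_self k), mul_assoc]
    · rw [descendingRun_succ_of_notMem hk, one_mul]
      exact dvd_mul_right _ _

theorem letter_mul_runProduct {m : ℕ} {i : Fin l} (h : m < i) :
    letter _ i * runProduct J m = runProduct J m * letter _ i := by
  induction m with
  | zero => simp [runProduct]
  | succ m ih =>
    rw [runProduct, ← mul_assoc, ih (by omega), mul_assoc, letter_mul_descendingRun h, mul_assoc]

theorem letter_dvd_of_dvd_runProduct_mul {m : ℕ} {i : Fin l} (h : m < i)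
    {e : ArtinMonoid (CoxeterMatrix.A l)} (hd : letter _ i ∣ runProduct J m * e) :
    letter _ i ∣ e := by
  induction m generalizing e with
  | zero => simpa [runProduct] using hd
  | succ m ih =>
    rw [runProduct, mul_assoc] at hd
    exact letter_dvd_of_dvd_descendingRun_mul h (ih (by omega) hd)

theorem letter_dvd_runProduct_succ {m : ℕ} (hl : m < l) (hm : (⟨m, hl⟩ : Fin l) ∈ J) :
    letter _ ⟨m, hl⟩ ∣ runProduct J (m + 1) := by
  cases m with
  | zero => simp [runProduct, descendingRun_succ_of_mem hl hm]
  | succ k =>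
    obtain ⟨y, hy⟩ := letter_dvd_descendingRun_mul hl hm
    refine ⟨runProduct J k * y, ?_⟩
    rw [← mul_assoc, letter_mul_runProduct (Nat.lt_succ_self k), mul_assoc, ← hy, runProduct,
      runProduct, mul_assoc]

theorem letter_dvd_runProduct {m : ℕ} {i : Fin l} (hi : i ∈ J) (him : i < m) :
    letter _ i ∣ runProduct J m := by
  induction m with
  | zero => omega
  | succ m ih =>
    rcases Nat.lt_succ_iff_lt_or_eq.1 him with h | rfl
    · exact (ih h).mul_right _
    · exact letter_dvd_runProduct_succ i.2 hi

/-- Runs are split off E one by one: a_m passes all earlier runs except the last, and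
`descendingRun_succ_dvd` handles that one. -/
theorem runProduct_dvd {E : ArtinMonoid (CoxeterMatrix.A l)} (hE : ∀ i ∈ J, letter _ i ∣ E)
    (m : ℕ) : runProduct J m ∣ E := by
  induction m with
  | zero => exact one_dvd _
  | succ m ih =>
    obtain ⟨e, rfl⟩ := ih
    rw [runProduct]
    apply mul_dvd_mul_left
    by_cases hm : ∃ h : m < l, (⟨m, h⟩ : Fin l) ∈ J
    · obtain ⟨hl, hm⟩ := hm
      apply descendingRun_succ_dvd hl hm
      have hd := hE _ hm
      cases m with
      | zero => exact hd
      | succ k =>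
        rw [runProduct, mul_assoc] at hd
        exact letter_dvd_of_dvd_runProduct_mul (Nat.lt_succ_self k) hd
    · rw [descendingRun_succ_of_notMem hm]
      exact one_dvd _

theorem isRightLCM_runProduct (J : Finset (Fin l)) :
    IsRightLCM (CoxeterMatrix.A l) J (runProduct J l) :=
  ⟨fun i hi => letter_dvd_runProduct hi i.2, fun _ hE => runProduct_dvd hE l⟩

theorem isRightLCM_fundamentalElement_A (J : Finset (Fin l)) :
    IsRightLCM (CoxeterMatrix.A l) J (fundamentalElement (CoxeterMatrix.A l) J) := by
  have h : ∃ D, IsRightLCM (CoxeterMatrix.A l) J D := ⟨_, isRightLCM_runProduct J⟩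
  rw [fundamentalElement, dif_pos h]
  exact h.choose_spec

theorem fundamentalElement_A (J : Finset (Fin l)) :
    fundamentalElement (CoxeterMatrix.A l) J = runProduct J l :=
  (isRightLCM_fundamentalElement_A J).unique _ (isRightLCM_runProduct J)

/-! ### The degree as a number of intervals. -/

/-- The interval `{m - k, …, m}` in `Fin l`. -/
def interval (l m k : ℕ) : Finset (Fin l) :=
  Finset.univ.filter fun i => m ≤ i + k ∧ (i : ℕ) ≤ m

theorem mem_interval {m k : ℕ} {i : Fin l} : i ∈ interval l m k ↔ m ≤ i + k ∧ (i : ℕ) ≤ m := by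
  simp [interval]

theorem card_interval {m k : ℕ} (hm : m < l) (hk : k ≤ m) : (interval l m k).card = k + 1 := by
  rw [← Finset.card_map Fin.valEmbedding]
  have : (interval l m k).map Fin.valEmbedding = Finset.Icc (m - k) m := by
    ext i
    simp only [Finset.mem_map, mem_interval, Fin.valEmbedding_apply, Finset.mem_Icc]
    constructor
    · rintro ⟨i, hi, rfl⟩
      omega
    · intro hi
      exact ⟨⟨i, by omega⟩, by simp only; omega, rfl⟩
  rw [this, Nat.card_Icc]
  omega

/-- The length of a run is the number of intervals in J with its top index. For m = 0 the sum is
empty, so the truncated m - 1 is harmless. -/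
theorem deg_descendingRun (J : Finset (Fin l)) {m : ℕ} (hm : m ≤ l) :
    deg _ (descendingRun J m) =
      ∑ k ∈ Finset.range m, if interval l (m - 1) k ⊆ J then 1 else 0 := by
  induction m with
  | zero => simp [descendingRun, deg_one]
  | succ m ih =>
    rw [Nat.add_sub_cancel]
    by_cases h : (⟨m, hm⟩ : Fin l) ∈ J
    · rw [descendingRun_succ_of_mem hm h, deg_mul, deg_letter, ih (by omega),
        Finset.sum_range_succ', if_pos, add_comm]
      · congr 1
        refine Finset.sum_congr rfl fun k hk => ?_
        rw [Finset.mem_range] at hk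
        congr 1
        simp only [Finset.subset_iff, mem_interval, eq_iff_iff]
        refine ⟨fun H i hi => ?_, fun H i hi => H (by omega)⟩
        by_cases him : (i : ℕ) = m
        · rwa [show i = ⟨m, hm⟩ from Fin.ext him]
        · exact H (by omega)
      · intro i hi
        rw [mem_interval] at hi
        rwa [show i = ⟨m, hm⟩ from Fin.ext (by simp only; omega)]
    · rw [descendingRun_succ_of_notMem (by rintro ⟨_, h'⟩; exact h h'), deg_one,
        Finset.sum_eq_zero]
      intro k _
      rw [if_neg]
      exact fun H => h (H (by rw [mem_interval]; simp only; omega))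

/-- The degree of the fundamental element of `J` is the number of intervals contained in `J`. -/
theorem deg_fundamentalElement_A (J : Finset (Fin l)) :
    deg _ (fundamentalElement (CoxeterMatrix.A l) J) =
      ∑ m ∈ Finset.range l, ∑ k ∈ Finset.range (m + 1),
        if interval l m k ⊆ J then 1 else 0 := by
  have (n : ℕ) (hn : n ≤ l) : deg _ (runProduct J n) =
      ∑ m ∈ Finset.range n, ∑ k ∈ Finset.range (m + 1),
        if interval l m k ⊆ J then 1 else 0 := by
    induction n with
    | zero => simp [runProduct, deg_one]
    | succ n ih =>
      rw [runProduct, deg_mul, ih (by omega), deg_descendingRun J hn, Nat.add_sub_cancel]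
      exact (Finset.sum_range_succ _ n).symm
  rw [fundamentalElement_A, this l le_rfl]

/-! ### Double counting of pairs (interval, superset). -/

/-- A sum over the sets containing `S` of a function of the cardinality. -/
theorem sum_card_of_subset {α : Type*} [Fintype α] [DecidableEq α] (f : ℕ → ℤ) (S : Finset α) :
    ∑ J : Finset α, (if S ⊆ J then f J.card else 0) =
      ∑ i ∈ Finset.range (Fintype.card α - S.card + 1),
        ((Fintype.card α - S.card).choose i : ℤ) * f (S.card + i) := by
  have key := Finset.sum_powerset_apply_card (fun i => f (S.card + i)) (x := Sᶜ)
  rw [Finset.card_compl] at key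
  simp only [nsmul_eq_mul] at key
  rw [← key, ← Finset.sum_filter]
  symm
  refine Finset.sum_bij' (fun T _ => S ∪ T) (fun J _ => J \ S) ?_ ?_ ?_ ?_ ?_
  · intro T _
    simp
  · intro J _
    rw [Finset.mem_powerset]
    intro x hx
    simp at hx ⊢
    exact hx.2
  · intro T hT
    rw [Finset.mem_powerset, Finset.subset_compl_iff_disjoint_left] at hT
    exact Finset.union_sdiff_cancel_left hT
  · intro J hJ
    exact Finset.union_sdiff_of_subset (Finset.mem_filter.1 hJ).2
  · intro T hT
    rw [Finset.mem_powerset, Finset.subset_compl_iff_disjoint_left] at hT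
    rw [Finset.card_union_of_disjoint hT]

/-- Double counting: the interval with top m has size k + 1, and i counts the further elements of J.
The weight f serves both as the indicator of a level and as the sign. -/
theorem sum_card_mul_deg_A (l : ℕ) (f : ℕ → ℤ) :
    ∑ J : Finset (Fin l), f J.card * (deg _ (fundamentalElement (CoxeterMatrix.A l) J) : ℤ) =
      ∑ m ∈ Finset.range l, ∑ k ∈ Finset.range (m + 1),
        ∑ i ∈ Finset.range (l - (k + 1) + 1), ((l - (k + 1)).choose i : ℤ) * f (k + 1 + i) := by
  simp only [deg_fundamentalElement_A, Nat.cast_sum, Finset.mul_sum]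
  rw [Finset.sum_comm]
  refine Finset.sum_congr rfl fun m hm => ?_
  rw [Finset.sum_comm]
  refine Finset.sum_congr rfl fun k hk => ?_
  rw [Finset.mem_range] at hm hk
  have := sum_card_of_subset f (interval l m k)
  rw [card_interval hm (by omega), Fintype.card_fin] at this
  rw [← this]
  refine Finset.sum_congr rfl fun J _ => ?_
  split_ifs <;> simp

theorem levelC_A (l j : ℕ) : levelC (CoxeterMatrix.A l) j =
    ∑ m ∈ Finset.range l, ∑ k ∈ Finset.range (m + 1),
      ∑ i ∈ Finset.range (l - (k + 1) + 1),
        ((l - (k + 1)).choose i : ℤ) * if k + 1 + i = j then 1 else 0 := by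
  rw [levelC_eq_sum, ← sum_card_mul_deg_A l fun i => if i = j then 1 else 0]
  simp only [ite_mul, one_mul, zero_mul]
  rw [← Finset.sum_filter]
  refine Finset.sum_congr ?_ fun _ _ => rfl
  ext J
  simp [Finset.mem_powersetCard]

theorem levelC_A_succ_succ (l j : ℕ) (h : j ≤ l) : levelC (CoxeterMatrix.A (l + 1)) (j + 1) =
    levelC (CoxeterMatrix.A l) j + ((j : ℤ) + 1) * ((l + 1).choose (j + 1) : ℤ) := by
  rw [levelC_A, levelC_A]
  have hsplit (m : ℕ) : ∑ k ∈ Finset.range (m + 1),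
      ∑ i ∈ Finset.range (l + 1 - (k + 1) + 1),
        ((l + 1 - (k + 1)).choose i : ℤ) * (if k + 1 + i = j + 1 then 1 else 0) =
      (∑ k ∈ Finset.range m, ∑ i ∈ Finset.range (l - (k + 1) + 1),
        ((l - (k + 1)).choose i : ℤ) * if k + 1 + i = j then 1 else 0) + l.choose j := by
    -- The term k = 0, a singleton interval, gives `l.choose j`; the others are the terms for A_l
    -- with k shifted by one.
    rw [Finset.sum_range_succ']
    congr 1
    · refine Finset.sum_congr rfl fun k _ => ?_
      rw [Nat.add_sub_add_right]
      refine Finset.sum_congr rfl fun i _ => ?_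
      congr 2
      rw [eq_iff_iff]
      omega
    · simp only [zero_add, Nat.add_sub_cancel, mul_ite, mul_one, mul_zero, Nat.add_comm 1,
        Nat.add_right_cancel_iff]
      rw [Finset.sum_ite_eq' (Finset.range (l + 1)) j, if_pos (by simpa using by omega)]
  rw [Finset.sum_congr rfl fun m _ => hsplit m, Finset.sum_add_distrib, Finset.sum_range_succ']
  simp only [Finset.range_zero, Finset.sum_empty, add_zero, Finset.sum_const, Finset.card_range,
    nsmul_eq_mul]
  congr 1
  have := Nat.add_one_mul_choose_eq l j
  rw [mul_comm ((j : ℤ) + 1)]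
  exact_mod_cast this

theorem derivative_skewGrowth_A_eval_one {l : ℕ} (hl : 1 ≤ l) :
    (Polynomial.derivative (skewGrowth (CoxeterMatrix.A l))).eval 1 = (-1 : ℤ) ^ l := by
  have h : (Polynomial.derivative (skewGrowth (CoxeterMatrix.A l))).eval 1 =
      ∑ J : Finset (Fin l),
        (-1) ^ J.card * (deg _ (fundamentalElement (CoxeterMatrix.A l) J) : ℤ) := by
    rw [skewGrowth, Polynomial.derivative_sum, Polynomial.eval_finsetSum]
    refine Finset.sum_congr rfl fun J _ => ?_
    rw [show ((-1 : ℤ[X]) ^ J.card) = Polynomial.C ((-1 : ℤ) ^ J.card) by simp]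
    rw [Polynomial.derivative_C_mul, Polynomial.eval_C_mul]
    simp [Polynomial.derivative_X_pow]
  rw [h, sum_card_mul_deg_A l fun i => (-1) ^ i]
  have hinner (k : ℕ) : ∑ i ∈ Finset.range (l - (k + 1) + 1),
      ((l - (k + 1)).choose i : ℤ) * (-1) ^ (k + 1 + i) =
      if l ≤ k + 1 then (-1) ^ (k + 1) else 0 := by
    have := congrArg (fun t : ℤ => (-1) ^ (k + 1) * t)
      (Int.alternating_sum_range_choose (n := l - (k + 1)))
    simp only [Finset.mul_sum] at this
    rw [Finset.sum_congr rfl fun i _ => show ((l - (k + 1)).choose i : ℤ) * (-1) ^ (k + 1 + i) =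
      (-1) ^ (k + 1) * ((-1) ^ i * ((l - (k + 1)).choose i : ℤ)) by ring, this]
    simp only [Nat.sub_eq_zero_iff_le, mul_ite, mul_one, mul_zero]
  simp only [hinner]
  -- Only m = k = l - 1, the full interval, survives.
  obtain ⟨n, rfl⟩ := Nat.exists_eq_add_of_le' hl
  rw [Finset.sum_range_succ, Finset.sum_eq_zero, zero_add, Finset.sum_range_succ,
    Finset.sum_eq_zero, zero_add, if_pos le_rfl]
  · intro k hk
    rw [Finset.mem_range] at hk
    rw [if_neg (by omega)]
  · intro m hm
    refine Finset.sum_eq_zero fun k hk => ?_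
    rw [Finset.mem_range] at hm hk
    rw [if_neg (by omega)]

end TypeA

end ArtinMonoid

/-- The fundamental elements of type `A_l` exist as right least common multiples, the numbers
`C_{A_l, j}` satisfy the recurrence, and the derivatives of the skew-growth functions at `t = 1`
are as stated. -/
theorem theorem3p6 :
    (∀ (l : ℕ) (J : Finset (Fin l)),
      ArtinMonoid.IsRightLCM (CoxeterMatrix.A l) J
        (ArtinMonoid.fundamentalElement (CoxeterMatrix.A l) J)) ∧
    (∀ l j : ℕ, 1 ≤ j → j ≤ l →
      ArtinMonoid.levelC (CoxeterMatrix.A (l + 1)) (j + 1) - ArtinMonoid.levelC (CoxeterMatrix.A l) j =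
        ((j : ℤ) + 1) * ((l + 1).choose (j + 1) : ℤ)) ∧
    (∀ l : ℕ, 1 ≤ l →
      (Polynomial.derivative (ArtinMonoid.skewGrowth (CoxeterMatrix.A (l + 1)))).eval 1 +
        (Polynomial.derivative (ArtinMonoid.skewGrowth (CoxeterMatrix.A l))).eval 1 = 0) ∧
    (∀ l : ℕ, 1 ≤ l →
      (Polynomial.derivative (ArtinMonoid.skewGrowth (CoxeterMatrix.A l))).eval 1 =
        (-1 : ℤ) ^ l) := by
  refine ⟨fun l J => ArtinMonoid.isRightLCM_fundamentalElement_A J, fun l j _ hj => ?_,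
    fun l hl => ?_, fun l hl => ArtinMonoid.derivative_skewGrowth_A_eval_one hl⟩
  · rw [ArtinMonoid.levelC_A_succ_succ l j hj, add_sub_cancel_left]
  · rw [ArtinMonoid.derivative_skewGrowth_A_eval_one hl,
      ArtinMonoid.derivative_skewGrowth_A_eval_one (by omega), pow_succ]
    ring
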